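/- Theorem (Reversibility property). Let $a,b,c,d,e\in\mathbb{R}$ with $b\neq 0$ and let $\gamma>-1/2$. Write $L^1_\gamma(\mathbb{R}_+)$ for the space of (classes of) measurable functions $h:\mathbb{R}_+\to\mathbb{C}$ with $\int_0^\infty |h(s)|\,s^{2\gamma+1}\,ds<\infty$, and put $$c_\gamma=\frac{1}{2^\gamma\Gamma(\gamma+1)},\qquad j_\gamma(s)=\Gamma(\gamma+1)\sum_{n=0}^\infty\frac{(-1)^n(s/2)^{2n}}{n!\,\Gamma(n+\gamma+1)},$$ $$\mathbb{J}^{a,b,c}_{d,e,\gamma}(t,s)=e^{-i(as^2+ct^2+ds+et)}\,j_\gamma(st/b).$$ For $h\in L^1_\gamma(\mathbb{R}_+)$ the quadratic-phase Fourier--Bessel transform of $h$ is $$\mathbb{B}^{a,b,c}_{d,e,\gamma}[h](t)=\frac{c_\gamma}{(ib)^{\gamma+1}}\int_0^\infty \mathbb{J}^{a,b,c}_{d,e,\gamma}(t,s)\,h(s)\,s^{2\gamma+1}\,ds,$$ with the principal branch of the power. Suppose that $h$ and $\mathbb{B}^{a,b,c}_{d,e,\gamma}[h]$ both belong to $L^1_\gamma(\mathbb{R}_+)$.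 Then, for almost every $s\in\mathbb{R}_+$, $$h(s)=\mathbb{B}^{-c,-b,-a}_{-e,-d,\gamma}\bigl(\mathbb{B}^{a,b,c}_{d,e,\gamma}[h]\bigr)(s)=\frac{c_\gamma}{(-ib)^{\gamma+1}}\int_0^\infty \mathbb{J}^{-c,-b,-a}_{-e,-d,\gamma}(s,t)\,\mathbb{B}^{a,b,c}_{d,e,\gamma}[h](t)\,t^{2\gamma+1}\,dt.$$ -/

import Mathlib

open MeasureTheory Set

noncomputable section

namespace QPFourierBessel

/-- The normalized Bessel function of order `γ`,
`j_γ(s) = Γ(γ+1) ∑ₙ (-1)ⁿ (s/2)^{2n} / (n! Γ(n+γ+1)) = 2^γ Γ(γ+1) J_γ(s) / s^γ`.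
The power series makes sense for every real `s` (including `s ≤ 0`) and is even in `s`. -/
def normalizedBessel (γ s : ℝ) : ℝ :=
  Real.Gamma (γ + 1) *
    ∑' n : ℕ, (-1 : ℝ) ^ n * (s / 2) ^ (2 * n) / ((n.factorial : ℝ) * Real.Gamma (n + γ + 1))

/-- The constant `c_γ = 1 / (2^γ Γ(γ+1))`. -/
def besselConst (γ : ℝ) : ℝ := 1 / ((2 : ℝ) ^ γ * Real.Gamma (γ + 1))

/-- The measure `s^{2γ+1} ds` on the half line `(0, ∞)`, as a measure on `ℝ`. -/
def besselMeasure (γ : ℝ) : Measure ℝ :=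
  (volume.restrict (Ioi (0 : ℝ))).withDensity fun s => ENNReal.ofReal (s ^ (2 * γ + 1))

/-- `h ∈ L¹_γ(ℝ₊)`: `h` is (a.e. strongly) measurable on the half line and
`∫₀^∞ |h(s)| s^{2γ+1} ds < ∞`. Values of `h` on `(-∞, 0]` are irrelevant. -/
def MemLOne (γ : ℝ) (h : ℝ → ℂ) : Prop := MemLp h 1 (besselMeasure γ)

/-- The quadratic-phase Fourier-Bessel kernel
`𝕁^{a,b,c}_{d,e,γ}(t,s) = exp(-i(a s² + c t² + d s + e t)) j_γ(s t / b)`. -/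
def kernel (a b c d e γ t s : ℝ) : ℂ :=
  Complex.exp (-Complex.I * ((a * s ^ 2 + c * t ^ 2 + d * s + e * t : ℝ) : ℂ)) *
    ((normalizedBessel γ (s * t / b) : ℝ) : ℂ)

/-- The quadratic-phase Fourier-Bessel transform
`𝔹^{a,b,c}_{d,e,γ}[h](t) = c_γ / (i b)^{γ+1} ∫₀^∞ 𝕁^{a,b,c}_{d,e,γ}(t,s) h(s) s^{2γ+1} ds`,
where the complex power is the principal one. -/
def transform (a b c d e γ : ℝ) (h : ℝ → ℂ) (t : ℝ) : ℂ :=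
  ((besselConst γ : ℝ) : ℂ) / (Complex.I * (b : ℂ)) ^ ((γ : ℂ) + 1) *
    ∫ s in Ioi (0 : ℝ), kernel a b c d e γ t s * h s * ((s ^ (2 * γ + 1) : ℝ) : ℂ)

end QPFourierBessel

end

/-! The phase of the kernel splits into a factor in `s` and a factor in `t`, so the transform is a
Hankel transform between two unimodular chirps. The second transform carries the inverse chirps and
`-b` in place of `b`. Since `j_γ` is even, the theorem reduces to L¹ inversion of the Hankel
transform H, namely HHf = K f, together with a check of constants.

Inversion is tested on Gaussians. Weber's integral sends a Gaussian to a Gaussian, and HH multiplies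
each by the same K (`hankel_hankel_gaussian`). Fubini makes H symmetric (`integral_hankel_mul`), so
HHf and K f have equal integrals against every Gaussian. By Weierstrass approximation in the
variable exp(-s²), Gaussians separate functions on the half line. The analytic input for Fubini is
|j_γ| ≤ 1, obtained from an energy estimate. -/

noncomputable section

namespace QPFourierBessel

/-! ### The Bessel series and the bound |j_γ| ≤ 1 -/

/-- The entire function `∑ₙ (-z)ⁿ / (n! Γ(n+γ+1))` (the Bessel–Clifford function at `-z`). -/
def besselClifford (γ z : ℝ) : ℝ :=
  ∑' n : ℕ, (-z) ^ n / ((n.factorial : ℝ) * Real.Gamma (n + γ + 1))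

lemma normalizedBessel_eq_besselClifford (γ s : ℝ) :
    normalizedBessel γ s = Real.Gamma (γ + 1) * besselClifford γ (s ^ 2 / 4) := by
  unfold normalizedBessel besselClifford
  congr 1
  refine tsum_congr fun n => ?_
  rw [pow_mul, ← mul_pow]
  congr 2
  ring

/-- Each step multiplies Γ by n+γ+1 > 1/2. This crude bound suffices to dominate the series by an
exponential one. -/
lemma Gamma_div_two_pow_le {γ : ℝ} (hγ : -(1 / 2 : ℝ) < γ) (n : ℕ) :
    Real.Gamma (γ + 1) / 2 ^ n ≤ Real.Gamma (n + γ + 1) := by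
  induction n with
  | zero => simp
  | succ n ih =>
    have hn : (0 : ℝ) ≤ n := n.cast_nonneg
    have h1 : Real.Gamma ((n + 1 : ℕ) + γ + 1) = (n + γ + 1) * Real.Gamma (n + γ + 1) := by
      rw [← Real.Gamma_add_one (by linarith)]
      push_cast
      ring_nf
    have h2 : 0 < Real.Gamma (n + γ + 1) := Real.Gamma_pos_of_pos (by linarith)
    rw [h1, pow_succ, ← div_div]
    nlinarith

lemma norm_besselClifford_term_le {γ : ℝ} (hγ : -(1 / 2 : ℝ) < γ) {z R : ℝ} (hz : |z| ≤ R) (n : ℕ) :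
    ‖(-z) ^ n / ((n.factorial : ℝ) * Real.Gamma (n + γ + 1))‖ ≤
      (Real.Gamma (γ + 1))⁻¹ * ((2 * R) ^ n / n.factorial) := by
  have hG : 0 < Real.Gamma (γ + 1) := Real.Gamma_pos_of_pos (by linarith)
  have hle := Gamma_div_two_pow_le hγ n
  have hpos : 0 < Real.Gamma (γ + 1) / 2 ^ n := by positivity
  have hf : (0 : ℝ) < n.factorial := by positivity
  rw [norm_div, norm_pow, norm_neg, Real.norm_eq_abs, Real.norm_of_nonneg
    (mul_nonneg hf.le (hpos.le.trans hle))]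
  calc |z| ^ n / (n.factorial * Real.Gamma (n + γ + 1))
      ≤ R ^ n / (n.factorial * (Real.Gamma (γ + 1) / 2 ^ n)) := by
        gcongr
        exact pow_nonneg ((abs_nonneg z).trans hz) n
    _ = _ := by
        rw [mul_pow]
        field_simp

lemma summable_besselClifford {γ : ℝ} (hγ : -(1 / 2 : ℝ) < γ) (z : ℝ) :
    Summable fun n : ℕ => (-z) ^ n / ((n.factorial : ℝ) * Real.Gamma (n + γ + 1)) :=
  Summable.of_norm_bounded ((Real.summable_pow_div_factorial _).mul_left _)
    (norm_besselClifford_term_le hγ le_rfl)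

lemma besselClifford_zero (γ : ℝ) : besselClifford γ 0 = (Real.Gamma (γ + 1))⁻¹ := by
  unfold besselClifford
  rw [tsum_eq_single 0 (fun n hn => by simp [hn])]
  simp

lemma hasDerivAt_besselClifford {γ : ℝ} (hγ : -(1 / 2 : ℝ) < γ) (z : ℝ) :
    HasDerivAt (besselClifford γ) (-besselClifford (γ + 1) z) z := by
  have hγ' : -(1 / 2 : ℝ) < γ + 1 := by linarith
  -- Splitting off the constant term makes the derivative of the n-th remaining term exactly minus
  -- the n-th term of order γ+1.
  have hshift : ∀ y, besselClifford γ y = (Real.Gamma (γ + 1))⁻¹ +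
      ∑' n : ℕ, (-y) ^ (n + 1) / (((n + 1).factorial : ℝ) * Real.Gamma ((n + 1 : ℕ) + γ + 1)) := by
    intro y
    unfold besselClifford
    rw [(summable_besselClifford hγ y).tsum_eq_zero_add]
    simp
  have hmain := hasDerivAt_tsum_of_isPreconnected (t := Metric.ball (0 : ℝ) (|z| + 1)) (y₀ := 0)
    (y := z)
    (g := fun (n : ℕ) y => (-y) ^ (n + 1) /
      (((n + 1).factorial : ℝ) * Real.Gamma ((n + 1 : ℕ) + γ + 1)))
    (g' := fun (n : ℕ) y => -((-y) ^ n / ((n.factorial : ℝ) * Real.Gamma (n + (γ + 1) + 1))))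
    ((Real.summable_pow_div_factorial (2 * (|z| + 1))).mul_left (Real.Gamma (γ + 1 + 1))⁻¹)
    Metric.isOpen_ball (convex_ball _ _).isPreconnected ?_ ?_ (by simp; positivity) ?_
    (by simp)
  · rw [show besselClifford γ = _ from funext hshift]
    have := hmain.const_add (Real.Gamma (γ + 1))⁻¹
    rwa [tsum_neg] at this
  · intro n y _
    have h1 := (((hasDerivAt_id y).neg).pow (n + 1)).div_const
      (((n + 1).factorial : ℝ) * Real.Gamma ((n + 1 : ℕ) + γ + 1))
    refine h1.congr_deriv ?_
    have e : ((n + 1 : ℕ) : ℝ) + γ + 1 = n + (γ + 1) + 1 := by push_cast; ring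
    have hG : Real.Gamma (n + (γ + 1) + 1) ≠ 0 :=
      (Real.Gamma_pos_of_pos (by have : (0 : ℝ) ≤ n := n.cast_nonneg
                                 linarith)).ne'
    rw [e, Nat.factorial_succ]
    push_cast
    have : (n.factorial : ℝ) ≠ 0 := by positivity
    have : (n + 1 : ℝ) ≠ 0 := by positivity
    simp only [Pi.neg_apply, id]
    field_simp
  · intro n y hy
    rw [norm_neg]
    exact norm_besselClifford_term_le hγ' (by simpa using (Metric.mem_ball.1 hy).le) n
  · simp

/-- Coefficientwise this is Γ(x+1) = xΓ(x). With the derivative formula it encodes Bessel's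
equation. -/
lemma besselClifford_recurrence {γ : ℝ} (hγ : -(1 / 2 : ℝ) < γ) (z : ℝ) :
    besselClifford γ z =
      (γ + 1) * besselClifford (γ + 1) z - z * besselClifford (γ + 1 + 1) z := by
  have s1 := summable_besselClifford (γ := γ + 1) (by linarith) z
  have s2 := summable_besselClifford (γ := γ + 1 + 1) (by linarith) z
  have s0 := summable_besselClifford hγ z
  unfold besselClifford
  rw [s0.tsum_eq_zero_add, s1.tsum_eq_zero_add, mul_add, add_sub_assoc, ← tsum_mul_left,
    ← tsum_mul_left, ← Summable.tsum_sub ((((summable_nat_add_iff 1).2 s1)).mul_left _)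
      (s2.mul_left _)]
  congr 1
  · simp only [pow_zero, Nat.factorial_zero, Nat.cast_one, Nat.cast_zero, zero_add, one_mul]
    rw [Real.Gamma_add_one (by linarith : γ + 1 ≠ 0)]
    have : Real.Gamma (γ + 1) ≠ 0 := (Real.Gamma_pos_of_pos (by linarith)).ne'
    have : γ + 1 ≠ 0 := by linarith
    field_simp
  · refine tsum_congr fun n => ?_
    have hn : (0 : ℝ) ≤ n := n.cast_nonneg
    have e1 : ((n + 1 : ℕ) : ℝ) + γ + 1 = n + γ + 2 := by push_cast; ring
    have e2 : ((n + 1 : ℕ) : ℝ) + (γ + 1) + 1 = n + γ + 2 + 1 := by push_cast; ring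
    have e3 : (n : ℝ) + (γ + 1 + 1) + 1 = n + γ + 2 + 1 := by ring
    have h0 : (n : ℝ) + γ + 2 ≠ 0 := by linarith
    rw [e1, e2, e3, Real.Gamma_add_one h0, Nat.factorial_succ, pow_succ]
    have : Real.Gamma (n + γ + 2) ≠ 0 := (Real.Gamma_pos_of_pos (by linarith)).ne'
    have : (n.factorial : ℝ) ≠ 0 := by positivity
    have : (n + 1 : ℝ) ≠ 0 := by positivity
    push_cast
    field_simp
    ring

lemma continuous_besselClifford {γ : ℝ} (hγ : -(1 / 2 : ℝ) < γ) :
    Continuous (besselClifford γ) :=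
  continuous_iff_continuousAt.2 fun z => (hasDerivAt_besselClifford hγ z).continuousAt

lemma continuous_normalizedBessel {γ : ℝ} (hγ : -(1 / 2 : ℝ) < γ) :
    Continuous (normalizedBessel γ) := by
  rw [show normalizedBessel γ = _ from funext (normalizedBessel_eq_besselClifford γ)]
  exact continuous_const.mul ((continuous_besselClifford hγ).comp (by fun_prop))

lemma normalizedBessel_neg (γ s : ℝ) : normalizedBessel γ (-s) = normalizedBessel γ s := by
  simp [normalizedBessel_eq_besselClifford]

/-- The energy `f² + f'²` of `f(s) = besselClifford γ (s²/4)` is nonincreasing on `[0, ∞)`. -/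
lemma antitoneOn_besselClifford_energy {γ : ℝ} (hγ : -(1 / 2 : ℝ) < γ) :
    AntitoneOn (fun s : ℝ => besselClifford γ (s ^ 2 / 4) ^ 2 +
      (s / 2 * besselClifford (γ + 1) (s ^ 2 / 4)) ^ 2) (Ici 0) := by
  have hγ' : -(1 / 2 : ℝ) < γ + 1 := by linarith
  have hd : ∀ s : ℝ, HasDerivAt (fun s : ℝ => besselClifford γ (s ^ 2 / 4) ^ 2 +
      (s / 2 * besselClifford (γ + 1) (s ^ 2 / 4)) ^ 2)
      (-(s * (2 * γ + 1) / 2 * besselClifford (γ + 1) (s ^ 2 / 4) ^ 2)) s := by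
    intro s
    have hq : HasDerivAt (fun s : ℝ => s ^ 2 / 4) (s / 2) s :=
      (((hasDerivAt_id s).pow 2).div_const 4).congr_deriv (by simp; ring)
    have h0 := (hasDerivAt_besselClifford hγ (s ^ 2 / 4)).comp s hq
    have h1 := (hasDerivAt_besselClifford hγ' (s ^ 2 / 4)).comp s hq
    have h2 := (h0.pow 2).add ((((hasDerivAt_id s).div_const 2).mul h1).pow 2)
    refine h2.congr_deriv ?_
    simp only [Function.comp_apply, id, Pi.mul_apply]
    -- Bessel's equation f'' + (2γ+1)f'/s + f = 0 in disguise: the energy has derivative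
    -- -2(2γ+1)f'²/s, nonpositive for s > 0 because γ > -1/2.
    rw [besselClifford_recurrence hγ]
    push_cast
    ring
  refine antitoneOn_of_deriv_nonpos (convex_Ici 0)
    (fun s _ => (hd s).continuousAt.continuousWithinAt)
    (fun s _ => (hd s).differentiableAt.differentiableWithinAt) fun s hs => ?_
  rw [(hd s).deriv, neg_nonpos]
  rw [interior_Ici, mem_Ioi] at hs
  have : 0 ≤ 2 * γ + 1 := by linarith
  positivity

lemma abs_normalizedBessel_le_one {γ : ℝ} (hγ : -(1 / 2 : ℝ) < γ) (s : ℝ) :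
    |normalizedBessel γ s| ≤ 1 := by
  have hG : 0 < Real.Gamma (γ + 1) := Real.Gamma_pos_of_pos (by linarith)
  have h := antitoneOn_besselClifford_energy hγ (mem_Ici.2 le_rfl) (mem_Ici.2 (abs_nonneg s))
    (abs_nonneg s)
  simp only [sq_abs] at h
  have h0 : besselClifford γ ((0 : ℝ) ^ 2 / 4) = (Real.Gamma (γ + 1))⁻¹ := by
    norm_num [besselClifford_zero]
  rw [h0] at h
  have h2 : besselClifford γ (s ^ 2 / 4) ^ 2 ≤ (Real.Gamma (γ + 1))⁻¹ ^ 2 := by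
    nlinarith [sq_nonneg (|s| / 2 * besselClifford (γ + 1) (s ^ 2 / 4))]
  have h3 := abs_le_of_sq_le_sq h2 (by positivity)
  rw [normalizedBessel_eq_besselClifford, abs_mul, abs_of_pos hG]
  calc _ ≤ Real.Gamma (γ + 1) * (Real.Gamma (γ + 1))⁻¹ := by
        gcongr
    _ = 1 := mul_inv_cancel₀ hG.ne'

/-! ### Gaussians separate functions on the half line -/

/-- A compactly supported function vanishing at `0` is a continuous function of `exp (-s²)`. -/
lemma continuous_comp_sqrt_neg_log {g : ℝ → ℝ} (hg : Continuous g) (hc : HasCompactSupport g)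
    (h0 : g 0 = 0) : Continuous fun u => g (Real.sqrt (-Real.log u)) := by
  refine continuous_iff_continuousAt.2 fun u => ?_
  by_cases hu : u = 0
  · subst hu
    have hlim : Filter.Tendsto (fun u => Real.sqrt (-Real.log u)) (nhdsWithin 0 {0}ᶜ)
        (Filter.cocompact ℝ) :=
      (Real.tendsto_sqrt_atTop.comp (Filter.tendsto_neg_atBot_atTop.comp
        Real.tendsto_log_nhdsNE_zero)).mono_right atTop_le_cocompact
    have hev : ∀ᶠ x in Filter.cocompact ℝ, g x = 0 := by
      filter_upwards [hc.isCompact.compl_mem_cocompact] with x hx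
      exact image_eq_zero_of_notMem_tsupport hx
    rw [continuousAt_iff_punctured_nhds]
    -- By the convention log 0 = 0 the value at u = 0 is g 0, which must therefore vanish to match
    -- the limit.
    simp only [Real.log_zero, neg_zero, Real.sqrt_zero, h0]
    exact tendsto_const_nhds.congr' ((hlim.eventually hev).mono fun _ h => h.symm)
  · exact hg.continuousAt.comp
      (Real.continuous_sqrt.continuousAt.comp (Real.continuousAt_log hu).neg)

/-- A function on the half line is determined by its integrals against Gaussians. -/
lemma ae_eq_zero_of_forall_integral_gaussian_eq_zero {μ : Measure ℝ} {f : ℝ → ℂ}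
    (hμ : ∀ᵐ s ∂μ, 0 < s)
    (hf : ∀ p : ℝ, 0 < p → Integrable (fun s => (Real.exp (-p * s ^ 2) : ℂ) * f s) μ)
    (h0 : ∀ p : ℝ, 0 < p → ∫ s, (Real.exp (-p * s ^ 2) : ℂ) * f s ∂μ = 0) :
    ∀ᵐ s ∂μ, f s = 0 := by
  -- `f` itself need not be integrable. The weight with p = 1 makes `w` integrable, and exp(-s²)ⁿ w
  -- is the Gaussian test with p = n+1.
  have hw := hf 1 one_pos
  set w : ℝ → ℂ := fun s => (Real.exp (-1 * s ^ 2) : ℂ) * f s with hw_def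
  have hpow : ∀ (n : ℕ) (s : ℝ), ((Real.exp (-s ^ 2) ^ n : ℝ) : ℂ) * w s =
      (Real.exp (-(n + 1) * s ^ 2) : ℂ) * f s := by
    intro n s
    rw [hw_def, ← mul_assoc, ← Complex.ofReal_mul, ← Real.exp_nat_mul, ← Real.exp_add]
    congr 3
    ring
  have hpoly : ∀ P : Polynomial ℝ,
      Integrable (fun s => ((P.eval (Real.exp (-s ^ 2)) : ℝ) : ℂ) * w s) μ ∧
      ∫ s, ((P.eval (Real.exp (-s ^ 2)) : ℝ) : ℂ) * w s ∂μ = 0 := by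
    intro P
    induction P using Polynomial.induction_on' with
    | add P Q hP hQ =>
      simp only [Polynomial.eval_add, Complex.ofReal_add, add_mul]
      exact ⟨hP.1.add hQ.1, by rw [integral_add hP.1 hQ.1, hP.2, hQ.2, add_zero]⟩
    | monomial n a =>
      simp only [Polynomial.eval_monomial, Complex.ofReal_mul, mul_assoc, hpow]
      refine ⟨(hf (n + 1) (by positivity)).const_mul _, ?_⟩
      rw [integral_const_mul, h0 (n + 1) (by positivity), mul_zero]
  have hzero := isOpen_Ioi.ae_eq_zero_of_integral_contDiff_smul_eq_zero (f := w) (μ := μ)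
    (U := Ioi (0 : ℝ)) (hw.locallyIntegrable.locallyIntegrableOn _) ?_
  · filter_upwards [hzero, hμ] with s hs hpos
    simpa [hw_def] using hs hpos
  intro g hg hc hsupp
  have hg0 : g 0 = 0 := image_eq_zero_of_notMem_tsupport fun h => lt_irrefl (0 : ℝ) (hsupp h)
  have hG := continuous_comp_sqrt_neg_log hg.continuous hc hg0
  have hgi : Integrable (fun s => g s • w s) μ := by
    obtain ⟨C, hC⟩ := hc.exists_bound_of_continuous hg.continuous
    exact hw.bdd_smul C hg.continuous.aestronglyMeasurable (ae_of_all _ hC)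
  have hbound : ∀ ε : ℝ, 0 < ε → ‖∫ s, g s • w s ∂μ‖ ≤ ε * ∫ s, ‖w s‖ ∂μ := by
    intro ε hε
    -- Weierstrass on [0,1] in the variable u = exp(-s²).
    obtain ⟨P, hP⟩ := exists_polynomial_near_of_continuousOn 0 1 _ hG.continuousOn ε hε
    obtain ⟨hPi, hP0⟩ := hpoly P
    rw [← sub_zero (∫ s, g s • w s ∂μ), ← hP0, ← integral_sub hgi hPi, ← integral_const_mul]
    refine norm_integral_le_of_norm_le (hw.norm.const_mul ε) ?_
    filter_upwards [hμ] with s hs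
    have h1 := hP (Real.exp (-s ^ 2)) ⟨(Real.exp_pos _).le, Real.exp_le_one_iff.2 (by nlinarith)⟩
    rw [Real.log_exp, neg_neg, Real.sqrt_sq hs.le] at h1
    rw [Complex.real_smul, ← sub_mul, ← Complex.ofReal_sub, norm_mul, Complex.norm_real,
      Real.norm_eq_abs, abs_sub_comm]
    gcongr
  rw [← norm_le_zero_iff]
  have hlim : Filter.Tendsto (fun ε : ℝ => ε * ∫ s, ‖w s‖ ∂μ) (nhdsWithin 0 (Ioi 0)) (nhds 0) := by
    have : Filter.Tendsto (fun ε : ℝ => ε * ∫ s, ‖w s‖ ∂μ) (nhds 0) (nhds (0 * ∫ s, ‖w s‖ ∂μ)) :=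
      (continuous_id.mul continuous_const).tendsto 0
    rw [zero_mul] at this
    exact this.mono_left nhdsWithin_le_nhds
  exact ge_of_tendsto hlim (eventually_mem_nhdsWithin.mono hbound)

/-! ### The weighted measure on the half line -/

lemma ae_besselMeasure_pos (γ : ℝ) : ∀ᵐ s ∂besselMeasure γ, 0 < s :=
  (withDensity_absolutelyContinuous _ _).ae_le (ae_restrict_mem measurableSet_Ioi)

lemma measurable_besselDensity (γ : ℝ) :
    Measurable fun s : ℝ => ENNReal.ofReal (s ^ (2 * γ + 1)) := by
  fun_prop

lemma ae_restrict_of_ae_besselMeasure {γ : ℝ} {p : ℝ → Prop} (h : ∀ᵐ s ∂besselMeasure γ, p s) :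
    ∀ᵐ s ∂(volume.restrict (Ioi (0 : ℝ))), p s := by
  rw [besselMeasure, ae_withDensity_iff (measurable_besselDensity γ)] at h
  filter_upwards [h, ae_restrict_mem measurableSet_Ioi] with s hs hpos
  exact hs (ENNReal.ofReal_pos.2 (Real.rpow_pos_of_pos hpos _)).ne'

lemma integral_besselMeasure {E : Type*} [NormedAddCommGroup E] [NormedSpace ℝ E]
    (γ : ℝ) (f : ℝ → E) :
    ∫ s, f s ∂besselMeasure γ = ∫ s in Ioi (0 : ℝ), s ^ (2 * γ + 1) • f s := by
  rw [besselMeasure, integral_withDensity_eq_integral_toReal_smul (measurable_besselDensity γ)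
    (by simp)]
  refine setIntegral_congr_fun measurableSet_Ioi fun s hs => ?_
  simp only [ENNReal.toReal_ofReal (Real.rpow_nonneg (le_of_lt hs) _)]

lemma integrable_besselMeasure_iff {E : Type*} [NormedAddCommGroup E] [NormedSpace ℝ E]
    (γ : ℝ) (f : ℝ → E) :
    Integrable f (besselMeasure γ) ↔
      IntegrableOn (fun s => s ^ (2 * γ + 1) • f s) (Ioi (0 : ℝ)) := by
  rw [besselMeasure, integrable_withDensity_iff_integrable_smul' (measurable_besselDensity γ)
    (by simp)]
  refine integrable_congr ?_
  filter_upwards [ae_restrict_mem measurableSet_Ioi] with s hs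
  rw [ENNReal.toReal_ofReal (Real.rpow_nonneg (le_of_lt hs) _)]

/-! ### Gaussian moments and Weber's integral -/

lemma rpow_mul_even_pow_mul_gaussian (γ p : ℝ) (n : ℕ) {s : ℝ} (hs : 0 < s) :
    s ^ (2 * γ + 1) • (s ^ (2 * n) * Real.exp (-p * s ^ 2)) =
      s ^ (2 * n + 2 * γ + 1) * Real.exp (-p * s ^ 2) := by
  rw [smul_eq_mul, ← mul_assoc, ← Real.rpow_natCast, ← Real.rpow_add hs]
  congr 2
  push_cast
  ring

lemma integrable_even_pow_mul_gaussian {γ p : ℝ} (hγ : -(1 / 2 : ℝ) < γ) (hp : 0 < p) (n : ℕ) :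
    Integrable (fun s : ℝ => s ^ (2 * n) * Real.exp (-p * s ^ 2)) (besselMeasure γ) := by
  rw [integrable_besselMeasure_iff]
  have hn : (0 : ℝ) ≤ n := n.cast_nonneg
  exact (integrableOn_rpow_mul_exp_neg_mul_sq hp (s := 2 * n + 2 * γ + 1) (by linarith)).congr_fun
    (fun s hs => (rpow_mul_even_pow_mul_gaussian γ p n hs).symm) measurableSet_Ioi

lemma integral_even_pow_mul_gaussian {γ p : ℝ} (hγ : -(1 / 2 : ℝ) < γ) (hp : 0 < p) (n : ℕ) :
    ∫ s, s ^ (2 * n) * Real.exp (-p * s ^ 2) ∂besselMeasure γ =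
      Real.Gamma (n + γ + 1) / (2 * p ^ (γ + 1) * p ^ n) := by
  rw [integral_besselMeasure, setIntegral_congr_fun measurableSet_Ioi
    (fun s hs => rpow_mul_even_pow_mul_gaussian γ p n hs)]
  have hn : (0 : ℝ) ≤ n := n.cast_nonneg
  have h := integral_rpow_mul_exp_neg_mul_rpow (p := 2) (q := 2 * n + 2 * γ + 1) (b := p)
    two_pos (by linarith) hp
  simp only [Real.rpow_two] at h
  rw [h, show (2 * (n : ℝ) + 2 * γ + 1 + 1) / 2 = n + γ + 1 by ring,
    show -(2 * (n : ℝ) + 2 * γ + 1 + 1) / 2 = -((γ + 1) + n) by ring, Real.rpow_neg hp.le,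
    Real.rpow_add hp, Real.rpow_natCast]
  field_simp

/-- Weber's integral: the Hankel transform of a Gaussian is a Gaussian. -/
lemma integral_normalizedBessel_mul_gaussian {γ p : ℝ} (hγ : -(1 / 2 : ℝ) < γ) (hp : 0 < p)
    (x : ℝ) :
    ∫ s, normalizedBessel γ (x * s) * Real.exp (-p * s ^ 2) ∂besselMeasure γ =
      Real.Gamma (γ + 1) / (2 * p ^ (γ + 1)) * Real.exp (-(x ^ 2 / (4 * p))) := by
  have hG : ∀ n : ℕ, 0 < Real.Gamma (n + γ + 1) := fun n =>
    Real.Gamma_pos_of_pos (by have : (0 : ℝ) ≤ n := n.cast_nonneg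
                              linarith)
  set F : ℕ → ℝ → ℝ := fun n s =>
    (-(x ^ 2 / 4)) ^ n / ((n.factorial : ℝ) * Real.Gamma (n + γ + 1)) *
      (s ^ (2 * n) * Real.exp (-p * s ^ 2)) with hF
  have hFi : ∀ n, Integrable (F n) (besselMeasure γ) := fun n =>
    (integrable_even_pow_mul_gaussian hγ hp n).const_mul _
  have hnorm : ∀ n s, ‖F n s‖ = (x ^ 2 / 4) ^ n / ((n.factorial : ℝ) * Real.Gamma (n + γ + 1)) *
      (s ^ (2 * n) * Real.exp (-p * s ^ 2)) := by
    intro n s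
    have h1 : 0 ≤ s ^ (2 * n) := (even_two_mul n).pow_nonneg s
    have h2 : 0 ≤ x ^ 2 / 4 := by positivity
    rw [hF, norm_mul, norm_div, norm_pow, norm_neg, Real.norm_of_nonneg h2,
      Real.norm_of_nonneg (mul_nonneg h1 (Real.exp_pos _).le),
      Real.norm_of_nonneg (mul_nonneg (by positivity) (hG n).le)]
  -- The Gamma factor of the moment cancels that of the Bessel coefficient, leaving an exponential
  -- series. Applied to y = x²/4 it also gives the summability that permits termwise integration.
  have hcoef : ∀ (n : ℕ) (y : ℝ), y ^ n / ((n.factorial : ℝ) * Real.Gamma (n + γ + 1)) *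
      (Real.Gamma (n + γ + 1) / (2 * p ^ (γ + 1) * p ^ n)) =
      1 / (2 * p ^ (γ + 1)) * ((y / p) ^ n / n.factorial) := by
    intro n y
    have := (hG n).ne'
    have : (n.factorial : ℝ) ≠ 0 := by positivity
    have : p ^ (γ + 1) ≠ 0 := (Real.rpow_pos_of_pos hp _).ne'
    rw [div_pow]
    field_simp
  have hsum := hasSum_integral_of_summable_integral_norm hFi (by
    simp only [hnorm, integral_const_mul, integral_even_pow_mul_gaussian hγ hp, hcoef]
    exact (Real.summable_pow_div_factorial _).mul_left _)
  have htsum : ∀ s, ∑' n, F n s =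
      (Real.Gamma (γ + 1))⁻¹ * (normalizedBessel γ (x * s) * Real.exp (-p * s ^ 2)) := by
    intro s
    rw [normalizedBessel_eq_besselClifford, ← mul_assoc, ← mul_assoc,
      inv_mul_cancel₀ (Real.Gamma_pos_of_pos (by linarith)).ne', one_mul, besselClifford,
      ← tsum_mul_right]
    refine tsum_congr fun n => ?_
    have hpow : (-((x * s) ^ 2 / 4)) ^ n = (-(x ^ 2 / 4)) ^ n * s ^ (2 * n) := by
      rw [pow_mul, ← mul_pow]
      congr 1
      ring
    simp only [hF, hpow]
    ring
  simp only [htsum] at hsum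
  simp only [hF, integral_const_mul, integral_even_pow_mul_gaussian hγ hp, hcoef] at hsum
  have hexp := (NormedSpace.expSeries_div_hasSum_exp (-(x ^ 2 / 4) / p)).mul_left
    (1 / (2 * p ^ (γ + 1)))
  rw [← Real.exp_eq_exp_ℝ] at hexp
  have heq := hsum.unique hexp
  have hG0 : Real.Gamma (γ + 1) ≠ 0 := (Real.Gamma_pos_of_pos (by linarith)).ne'
  rw [inv_mul_eq_iff_eq_mul₀ hG0] at heq
  rw [heq, show -(x ^ 2 / 4) / p = -(x ^ 2 / (4 * p)) by field_simp]
  ring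

/-! ### The Hankel transform and its inversion -/

instance sFinite_besselMeasure (γ : ℝ) : SFinite (besselMeasure γ) := by
  unfold besselMeasure
  infer_instance

/-- The unnormalized Hankel transform `t ↦ ∫ j_γ(st/b) f(s) s^{2γ+1} ds`. -/
def hankel (γ b : ℝ) (f : ℝ → ℂ) (t : ℝ) : ℂ :=
  ∫ s, ((normalizedBessel γ (s * t / b) : ℝ) : ℂ) * f s ∂besselMeasure γ

lemma hankel_neg (γ b : ℝ) (f : ℝ → ℂ) (t : ℝ) : hankel γ (-b) f t = hankel γ b f t := by
  simp only [hankel, div_neg, normalizedBessel_neg]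

lemma hankel_const_mul (γ b : ℝ) (C : ℂ) (f : ℝ → ℂ) (t : ℝ) :
    hankel γ b (fun s => C * f s) t = C * hankel γ b f t := by
  simp only [hankel, mul_left_comm _ C, integral_const_mul]

lemma norm_normalizedBessel_le_one {γ : ℝ} (hγ : -(1 / 2 : ℝ) < γ) (x : ℝ) :
    ‖((normalizedBessel γ x : ℝ) : ℂ)‖ ≤ 1 := by
  simpa using abs_normalizedBessel_le_one hγ x

lemma norm_hankel_le {γ : ℝ} (hγ : -(1 / 2 : ℝ) < γ) (b : ℝ) {f : ℝ → ℂ}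
    (hf : Integrable f (besselMeasure γ)) (t : ℝ) :
    ‖hankel γ b f t‖ ≤ ∫ s, ‖f s‖ ∂besselMeasure γ := by
  refine norm_integral_le_of_norm_le hf.norm (ae_of_all _ fun s => ?_)
  rw [norm_mul]
  exact mul_le_of_le_one_left (norm_nonneg _) (norm_normalizedBessel_le_one hγ _)

lemma aestronglyMeasurable_hankel {γ : ℝ} (hγ : -(1 / 2 : ℝ) < γ) (b : ℝ) {f : ℝ → ℂ}
    (hf : Integrable f (besselMeasure γ)) :
    AEStronglyMeasurable (hankel γ b f) (besselMeasure γ) := by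
  have hj := continuous_normalizedBessel hγ
  have h1 : Continuous fun z : ℝ × ℝ => ((normalizedBessel γ (z.2 * z.1 / b) : ℝ) : ℂ) := by
    fun_prop
  exact (h1.aestronglyMeasurable.mul
    (hf.aestronglyMeasurable.comp_snd (μ := besselMeasure γ))).integral_prod_right'

/-- The Hankel transform is symmetric for the bilinear pairing of integrable functions. -/
lemma integral_hankel_mul {γ : ℝ} (hγ : -(1 / 2 : ℝ) < γ) (b : ℝ) {f g : ℝ → ℂ}
    (hf : Integrable f (besselMeasure γ)) (hg : Integrable g (besselMeasure γ)) :
    ∫ t, hankel γ b f t * g t ∂besselMeasure γ = ∫ s, f s * hankel γ b g s ∂besselMeasure γ := by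
  have hj := continuous_normalizedBessel hγ
  have h1 : Continuous fun z : ℝ × ℝ => ((normalizedBessel γ (z.2 * z.1 / b) : ℝ) : ℂ) := by
    fun_prop
  have hint : Integrable (Function.uncurry fun t s : ℝ =>
      ((normalizedBessel γ (s * t / b) : ℝ) : ℂ) * (g t * f s))
      ((besselMeasure γ).prod (besselMeasure γ)) :=
    (hg.mul_prod hf).bdd_mul h1.aestronglyMeasurable
      (ae_of_all _ fun z => norm_normalizedBessel_le_one hγ _)
  calc ∫ t, hankel γ b f t * g t ∂besselMeasure γ
      = ∫ t, ∫ s, ((normalizedBessel γ (s * t / b) : ℝ) : ℂ) * (g t * f s)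
          ∂besselMeasure γ ∂besselMeasure γ := by
        refine integral_congr_ae (ae_of_all _ fun t => ?_)
        simp only [hankel, ← integral_mul_const]
        refine integral_congr_ae (ae_of_all _ fun s => ?_)
        simp only
        ring
    _ = ∫ s, ∫ t, ((normalizedBessel γ (s * t / b) : ℝ) : ℂ) * (g t * f s)
          ∂besselMeasure γ ∂besselMeasure γ := integral_integral_swap hint
    _ = ∫ s, f s * hankel γ b g s ∂besselMeasure γ := by
        refine integral_congr_ae (ae_of_all _ fun s => ?_)
        simp only [hankel, ← integral_const_mul]
        refine integral_congr_ae (ae_of_all _ fun t => ?_)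
        simp only [mul_comm t s]
        ring

lemma integrable_gaussian {γ p : ℝ} (hγ : -(1 / 2 : ℝ) < γ) (hp : 0 < p) :
    Integrable (fun s : ℝ => (Real.exp (-p * s ^ 2) : ℂ)) (besselMeasure γ) := by
  simpa using (integrable_even_pow_mul_gaussian hγ hp 0).ofReal (𝕜 := ℂ)

lemma hankel_gaussian {γ p b : ℝ} (hγ : -(1 / 2 : ℝ) < γ) (hp : 0 < p) (t : ℝ) :
    hankel γ b (fun s => (Real.exp (-p * s ^ 2) : ℂ)) t =
      ((Real.Gamma (γ + 1) / (2 * p ^ (γ + 1)) : ℝ) : ℂ) *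
        (Real.exp (-(1 / (4 * p * b ^ 2)) * t ^ 2) : ℂ) := by
  rw [← Complex.ofReal_mul, show -(1 / (4 * p * b ^ 2)) * t ^ 2 = -((t / b) ^ 2 / (4 * p)) by
    rw [div_pow]; field_simp, ← integral_normalizedBessel_mul_gaussian hγ hp,
    ← integral_complex_ofReal]
  refine integral_congr_ae (ae_of_all _ fun s => ?_)
  simp only [Complex.ofReal_mul]
  congr 3
  ring

/-- The map p ↦ 1/(4pb²) is an involution, so the second transform restores the Gaussian. The powers
of p in the two constants cancel, so the factor does not depend on p. -/
lemma hankel_hankel_gaussian {γ p b : ℝ} (hγ : -(1 / 2 : ℝ) < γ) (hb : b ≠ 0) (hp : 0 < p)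
    (t : ℝ) :
    hankel γ b (hankel γ b (fun s => (Real.exp (-p * s ^ 2) : ℂ))) t =
      (((|b| ^ (γ + 1) / besselConst γ) ^ 2 : ℝ) : ℂ) * (Real.exp (-p * t ^ 2) : ℂ) := by
  have hq : 0 < 1 / (4 * p * b ^ 2) := by positivity
  rw [show hankel γ b (fun s => (Real.exp (-p * s ^ 2) : ℂ)) = _ from
    funext (hankel_gaussian hγ hp), hankel_const_mul, hankel_gaussian hγ hq, ← mul_assoc,
    ← Complex.ofReal_mul, show 1 / (4 * (1 / (4 * p * b ^ 2)) * b ^ 2) = p by field_simp]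
  congr 2
  have h2 : (1 / (4 * p * b ^ 2)) ^ (γ + 1) =
      ((2 ^ (γ + 1)) ^ 2 * p ^ (γ + 1) * (|b| ^ (γ + 1)) ^ 2)⁻¹ := by
    rw [one_div, Real.inv_rpow (by positivity), Real.mul_rpow (by positivity) (by positivity),
      Real.mul_rpow (by positivity) hp.le, show (4 : ℝ) = 2 ^ 2 by norm_num, ← sq_abs b,
      ← Real.rpow_natCast_mul two_pos.le, ← Real.rpow_natCast_mul (abs_nonneg b),
      ← Real.rpow_mul_natCast two_pos.le, ← Real.rpow_mul_natCast (abs_nonneg b),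
      mul_comm ((2 : ℕ) : ℝ)]
  rw [h2, besselConst, Real.rpow_add_one two_ne_zero]
  have : p ^ (γ + 1) ≠ 0 := (Real.rpow_pos_of_pos hp _).ne'
  have : (2 : ℝ) ^ γ ≠ 0 := (Real.rpow_pos_of_pos two_pos _).ne'
  have : Real.Gamma (γ + 1) ≠ 0 := (Real.Gamma_pos_of_pos (by linarith)).ne'
  field_simp

/-- Inversion of the Hankel transform in `L¹`. -/
lemma hankel_hankel_ae_eq {γ b : ℝ} (hγ : -(1 / 2 : ℝ) < γ) (hb : b ≠ 0) {f : ℝ → ℂ}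
    (hf : Integrable f (besselMeasure γ)) (hHf : Integrable (hankel γ b f) (besselMeasure γ)) :
    ∀ᵐ s ∂besselMeasure γ, hankel γ b (hankel γ b f) s =
      (((|b| ^ (γ + 1) / besselConst γ) ^ 2 : ℝ) : ℂ) * f s := by
  set K : ℂ := (((|b| ^ (γ + 1) / besselConst γ) ^ 2 : ℝ) : ℂ) with hK
  have hint1 : ∀ p : ℝ, 0 < p → Integrable
      (fun s => hankel γ b (hankel γ b f) s * (Real.exp (-p * s ^ 2) : ℂ)) (besselMeasure γ) :=
    fun p hp => (integrable_gaussian hγ hp).bdd_mul (aestronglyMeasurable_hankel hγ b hHf)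
      (ae_of_all _ (norm_hankel_le hγ b hHf))
  have hint2 : ∀ p : ℝ, 0 < p → Integrable
      (fun s => (Real.exp (-p * s ^ 2) : ℂ) * (K * f s)) (besselMeasure γ) := fun p hp =>
    (hf.const_mul K).bdd_mul (c := 1) (by fun_prop) (ae_of_all _ fun s => by
      rw [Complex.norm_real, Real.norm_of_nonneg (Real.exp_pos _).le, Real.exp_le_one_iff]
      nlinarith [sq_nonneg s])
  have hsub : ∀ (p s : ℝ), (Real.exp (-p * s ^ 2) : ℂ) * (hankel γ b (hankel γ b f) s - K * f s) =
      hankel γ b (hankel γ b f) s * (Real.exp (-p * s ^ 2) : ℂ) -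
        (Real.exp (-p * s ^ 2) : ℂ) * (K * f s) := fun p s => by ring
  -- HHf is only known to be bounded, so the difference becomes integrable after Gaussian damping.
  -- Symmetry applied twice moves both transforms onto the Gaussian.
  have hzero := ae_eq_zero_of_forall_integral_gaussian_eq_zero
    (f := fun s => hankel γ b (hankel γ b f) s - K * f s) (ae_besselMeasure_pos γ)
    (fun p hp => by
      simp only [hsub]
      exact (hint1 p hp).sub (hint2 p hp))
    (fun p hp => by
      have hG := integrable_gaussian hγ hp
      have hHG : Integrable (hankel γ b fun s => (Real.exp (-p * s ^ 2) : ℂ))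
          (besselMeasure γ) := by
        rw [show hankel γ b (fun s => (Real.exp (-p * s ^ 2) : ℂ)) = _ from
          funext (hankel_gaussian hγ hp)]
        exact (integrable_gaussian hγ (p := 1 / (4 * p * b ^ 2)) (by positivity)).const_mul _
      simp only [hsub]
      rw [integral_sub (hint1 p hp) (hint2 p hp), integral_hankel_mul hγ b hHf hG,
        integral_hankel_mul hγ b hf hHG, sub_eq_zero]
      refine integral_congr_ae (ae_of_all _ fun s => ?_)
      simp only [hankel_hankel_gaussian hγ hb hp, hK]
      ring)
  filter_upwards [hzero] with s hs
  exact sub_eq_zero.1 hs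

/-! ### Chirps and the principal power -/

/-- The chirp `exp (-i (u s² + v s))`. -/
def chirp (u v s : ℝ) : ℂ := Complex.exp (-Complex.I * ((u * s ^ 2 + v * s : ℝ) : ℂ))

lemma continuous_chirp (u v : ℝ) : Continuous (chirp u v) := by
  unfold chirp
  fun_prop

lemma norm_chirp (u v s : ℝ) : ‖chirp u v s‖ = 1 := by
  rw [chirp, neg_mul, mul_comm, ← neg_mul, ← Complex.ofReal_neg, Complex.norm_exp_ofReal_mul_I]

lemma chirp_neg_mul_chirp (u v s : ℝ) : chirp (-u) (-v) s * chirp u v s = 1 := by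
  rw [chirp, chirp, ← Complex.exp_add, ← Complex.exp_zero]
  congr 1
  push_cast
  ring

lemma integrable_chirp_mul {μ : Measure ℝ} (u v : ℝ) {f : ℝ → ℂ} (hf : Integrable f μ) :
    Integrable (fun s => chirp u v s * f s) μ :=
  hf.bdd_mul (c := 1) (continuous_chirp u v).aestronglyMeasurable
    (ae_of_all _ fun s => le_of_eq (norm_chirp u v s))

lemma transform_eq_hankel (a b c d e γ : ℝ) (h : ℝ → ℂ) (t : ℝ) :
    transform a b c d e γ h t =
      ((besselConst γ : ℝ) : ℂ) / (Complex.I * (b : ℂ)) ^ ((γ : ℂ) + 1) *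
        (chirp c e t * hankel γ b (fun s => chirp a d s * h s) t) := by
  rw [transform, hankel, integral_besselMeasure, ← integral_const_mul (chirp c e t)]
  congr 1
  refine setIntegral_congr_fun measurableSet_Ioi fun s _ => ?_
  have hsplit : Complex.exp (-Complex.I * ((a * s ^ 2 + c * t ^ 2 + d * s + e * t : ℝ) : ℂ)) =
      chirp c e t * chirp a d s := by
    rw [chirp, chirp, ← Complex.exp_add]
    congr 1
    push_cast
    ring
  simp only [kernel, hsplit, Complex.real_smul]
  ring

/-- The principal logarithms of I and -I are opposite, so the phases cancel and only the moduli
remain. The sign of b merely swaps the two factors. -/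
lemma I_mul_cpow_mul_neg_cpow {b γ : ℝ} (hb : b ≠ 0) :
    (Complex.I * (b : ℂ)) ^ ((γ : ℂ) + 1) * (Complex.I * ((-b : ℝ) : ℂ)) ^ ((γ : ℂ) + 1) =
      (((|b| ^ (γ + 1)) ^ 2 : ℝ) : ℂ) := by
  have key : ∀ x : ℝ, 0 < x →
      (Complex.I * (x : ℂ)) ^ ((γ : ℂ) + 1) * (Complex.I * ((-x : ℝ) : ℂ)) ^ ((γ : ℂ) + 1) =
        (((x ^ (γ + 1)) ^ 2 : ℝ) : ℂ) := by
    intro x hx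
    have hx0 : (x : ℂ) ≠ 0 := Complex.ofReal_ne_zero.2 hx.ne'
    have h1 : Complex.I * ((-x : ℝ) : ℂ) = (x : ℂ) * (-Complex.I) := by push_cast; ring
    rw [h1, mul_comm Complex.I, Complex.cpow_def_of_ne_zero (mul_ne_zero hx0 Complex.I_ne_zero),
      Complex.cpow_def_of_ne_zero (mul_ne_zero hx0 (neg_ne_zero.2 Complex.I_ne_zero)),
      Complex.log_ofReal_mul hx Complex.I_ne_zero,
      Complex.log_ofReal_mul hx (neg_ne_zero.2 Complex.I_ne_zero), Complex.log_I,
      Complex.log_neg_I, ← Complex.exp_add, Real.rpow_def_of_pos hx, ← Real.exp_nat_mul,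
      Complex.ofReal_exp]
    congr 1
    push_cast
    ring
  rcases lt_or_gt_of_ne hb with h | h
  · have := key (-b) (neg_pos.2 h)
    rw [abs_of_neg h, mul_comm]
    rwa [neg_neg] at this
  · rw [abs_of_pos h]
    exact key b h

end QPFourierBessel

end

/-! ### Reversibility -/

theorem mainTheorem2 (a b c d e γ : ℝ) (hb : b ≠ 0) (hγ : -(1 / 2 : ℝ) < γ) (h : ℝ → ℂ)
    (hh : QPFourierBessel.MemLOne γ h)
    (hBh : QPFourierBessel.MemLOne γ (QPFourierBessel.transform a b c d e γ h)) :
    ∀ᵐ s ∂(MeasureTheory.volume.restrict (Set.Ioi (0 : ℝ))),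
      h s = QPFourierBessel.transform (-c) (-b) (-a) (-e) (-d) γ
          (QPFourierBessel.transform a b c d e γ h) s ∧
      h s = ((QPFourierBessel.besselConst γ : ℝ) : ℂ) /
            (-(Complex.I * (b : ℂ))) ^ ((γ : ℂ) + 1) *
          ∫ t in Set.Ioi (0 : ℝ),
            QPFourierBessel.kernel (-c) (-b) (-a) (-e) (-d) γ s t *
              QPFourierBessel.transform a b c d e γ h t *
              ((t ^ (2 * γ + 1) : ℝ) : ℂ) := by
  open QPFourierBessel in
  have hG : 0 < Real.Gamma (γ + 1) := Real.Gamma_pos_of_pos (by linarith)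
  have hcγ : 0 < besselConst γ := by unfold besselConst; positivity
  have hI : Complex.I * ((-b : ℝ) : ℂ) = -(Complex.I * (b : ℂ)) := by push_cast; ring
  set A : ℂ := ((besselConst γ : ℝ) : ℂ) / (Complex.I * (b : ℂ)) ^ ((γ : ℂ) + 1) with hA
  have hA0 : A ≠ 0 := by
    refine div_ne_zero (Complex.ofReal_ne_zero.2 hcγ.ne') ?_
    rw [Complex.cpow_ne_zero_iff]
    left
    exact mul_ne_zero Complex.I_ne_zero (Complex.ofReal_ne_zero.2 hb)
  set f : ℝ → ℂ := fun s => chirp a d s * h s with hf_def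
  have hf : Integrable f (besselMeasure γ) :=
    integrable_chirp_mul a d (memLp_one_iff_integrable.1 hh)
  -- The input chirp of the second transform undoes the output chirp of the first.
  have hchirp : ∀ t, chirp (-c) (-e) t * transform a b c d e γ h t = A * hankel γ b f t := by
    intro t
    rw [transform_eq_hankel, ← hA, mul_left_comm, ← mul_assoc (chirp (-c) (-e) t),
      chirp_neg_mul_chirp, one_mul]
  -- Integrability passes from the transform to the Hankel transform since chirps are unimodular and
  -- `A` is nonzero.
  have hHf : Integrable (hankel γ b f) (besselMeasure γ) := by
    have h1 := integrable_chirp_mul (-c) (-e) (memLp_one_iff_integrable.1 hBh)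
    simp only [hchirp] at h1
    exact (integrable_const_mul_iff hA0.isUnit _).1 h1
  have hmain : ∀ᵐ s ∂(volume.restrict (Ioi (0 : ℝ))), h s =
      transform (-c) (-b) (-a) (-e) (-d) γ (transform a b c d e γ h) s := by
    filter_upwards [ae_restrict_of_ae_besselMeasure (hankel_hankel_ae_eq hγ hb hf hHf)] with s hs
    have hconst : ((besselConst γ : ℝ) : ℂ) / (Complex.I * ((-b : ℝ) : ℂ)) ^ ((γ : ℂ) + 1) * A *
        (((|b| ^ (γ + 1) / besselConst γ) ^ 2 : ℝ) : ℂ) = 1 := by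
      have hb' : |b| ^ (γ + 1) ≠ 0 := (Real.rpow_pos_of_pos (abs_pos.2 hb) _).ne'
      rw [hA, div_mul_div_comm, mul_comm (_ ^ _), I_mul_cpow_mul_neg_cpow hb,
        ← Complex.ofReal_mul, ← Complex.ofReal_div, ← Complex.ofReal_mul, ← Complex.ofReal_one]
      congr 1
      field_simp
    rw [transform_eq_hankel]
    simp only [hchirp]
    rw [hankel_neg, hankel_const_mul, hs, hf_def]
    linear_combination (-h s * (chirp (-a) (-d) s * chirp a d s)) * hconst -
      h s * chirp_neg_mul_chirp a d s
  filter_upwards [hmain] with s hs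
  refine ⟨hs, ?_⟩
  -- The explicit formula differs only in writing the base as -(ib) instead of i(-b).
  rw [← hI]
  exact hs
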